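/- Let $n\ge 1$ and let $\Delta^n=\{p\in\mathbb{R}^n : p_i\ge 0,\ \sum_i p_i=1\}$, with relative interior $\operatorname{int}(\Delta^n)=\{p\in\Delta^n : p_i>0 \text{ for all } i\}$. A loss is a map $\ell=(\ell_1,\dots,\ell_n)\colon\Delta^n\to[0,\infty]^n$ with continuous components that are finite on $\operatorname{int}(\Delta^n)$ (the value $\infty$ may occur on the relative boundary, as it does for the log loss $\ell_{\log}(p)=(-\ln p_1,\dots,-\ln p_n)$, where $-\ln 0=\infty$). The loss $\ell$ is *proper* if $\sum_i p_i\ell_i(p)\le\sum_i p_i\ell_i(q)$ for all $p,q\in\Delta^n$ (with $0\cdot\infty=0$). It is *admissible*, written $\ell\in\mathcal{L}_n$, if $M=\ell(\operatorname{int}(\Delta^n))\subset\mathbb{R}^n$ is an $(n-1)$-dimensional (embedded) manifold of class $C^2$ and there is a differentiable map $\mathbf{n}\colon M\to\mathbb{R}^n$ such that, for every $x\in M$, the vector $\mathbf{n}(x)$ is normal to $M$ at $x$ and $\mathbf{n}(x)$ or $-\mathbf{n}(x)$ has all coordinates positive. The superprediction set of $\ell$ is $$\operatorname{spr}(\ell)=\{x\in[0,\infty)^n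 : \text{there is } q\in\Delta^n \text{ with } \ell_i(q)\le x_i \text{ for all } i\}.$$ For $\eta>0$ let $E_\eta(y)=(e^{-\eta y_1},\dots,e^{-\eta y_n})$; the loss $\ell$ is *$\eta$-mixable* if $E_\eta(\operatorname{spr}(\ell))$ is convex. For sets $L,K\subset\mathbb{R}^n$, $L$ *slides freely inside* $K$ if for every boundary point $x$ of $K$ there is $t\in\mathbb{R}^n$ with $x\in L+t\subset K$. **Theorem.** Let $\ell\in\mathcal{L}_n$ be proper and let $\eta>0$. Then $\ell$ is $\eta$-mixable if and only if $\operatorname{spr}(\eta\ell)$ slides freely inside $\operatorname{spr}(\ell_{\log})$. -/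

import Mathlib

open scoped ENNReal Topology

namespace Mixability

/-- A map `ℓ : Δⁿ → [0, ∞]ⁿ` on the probability simplex is a loss function if its partial losses
are continuous and finite on the relative interior of the simplex. The value `∞` is allowed on the
relative boundary, so that the log loss is a loss function; losses with values in `[0, ∞)ⁿ` are the
special case in which it is not taken. -/
def IsLoss {n : ℕ} (ℓ : stdSimplex ℝ (Fin n) → Fin n → ℝ≥0∞) : Prop :=
  (∀ i, Continuous fun p => ℓ p i) ∧ ∀ p, (∀ j, 0 < p.1 j) → ∀ i, ℓ p i ≠ ∞

/-- The conditional risk `L(p, q) = ⟨ℓ(q), p⟩`, with the convention `0 · ∞ = 0`. -/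
noncomputable def condRisk {n : ℕ} (ℓ : stdSimplex ℝ (Fin n) → Fin n → ℝ≥0∞)
    (p q : stdSimplex ℝ (Fin n)) : ℝ≥0∞ :=
  ∑ i, ENNReal.ofReal (p.1 i) * ℓ q i

/-- `ℓ` is proper: for every `p`, the conditional risk `L(p, ·)` has a minimum at `p`. -/
def IsProper {n : ℕ} (ℓ : stdSimplex ℝ (Fin n) → Fin n → ℝ≥0∞) : Prop :=
  ∀ p q, condRisk ℓ p p ≤ condRisk ℓ p q

/-- The point `ℓ(p)` of `ℝⁿ` (meaningful where `ℓ(p)` is finite). -/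
noncomputable def lossPoint {n : ℕ} (ℓ : stdSimplex ℝ (Fin n) → Fin n → ℝ≥0∞)
    (p : stdSimplex ℝ (Fin n)) : Fin n → ℝ :=
  fun i => (ℓ p i).toReal

/-- The loss surface `ℓ(int Δⁿ) ⊆ ℝⁿ`. -/
def lossSurface {n : ℕ} (ℓ : stdSimplex ℝ (Fin n) → Fin n → ℝ≥0∞) : Set (Fin n → ℝ) :=
  lossPoint ℓ '' {p | ∀ j, 0 < p.1 j}

/-- `M ⊆ ℝⁿ` is an (embedded) `(n - 1)`-dimensional manifold of class `C²`: near each of its points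
it is the zero set of a `C²` function whose derivative at the point does not vanish. -/
def IsC2Hypersurface {n : ℕ} (M : Set (Fin n → ℝ)) : Prop :=
  ∀ x ∈ M, ∃ (U : Set (Fin n → ℝ)) (F : (Fin n → ℝ) → ℝ), IsOpen U ∧ x ∈ U ∧
    ContDiffOn ℝ 2 F U ∧ fderiv ℝ F x ≠ 0 ∧ M ∩ U = {y ∈ U | F y = 0}

/-- `v` is tangent to `M` at `x`: it is the velocity of a curve in `M` through `x`. -/
def IsTangentVector {n : ℕ} (M : Set (Fin n → ℝ)) (x v : Fin n → ℝ) : Prop :=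
  ∃ γ : ℝ → Fin n → ℝ, γ 0 = x ∧ (∀ᶠ t in 𝓝 0, γ t ∈ M) ∧ HasDerivAt γ v 0

/-- `w` is normal to `M` at `x`: it is orthogonal to all tangent vectors of `M` at `x`. -/
def IsNormalVector {n : ℕ} (M : Set (Fin n → ℝ)) (x w : Fin n → ℝ) : Prop :=
  ∀ v, IsTangentVector M x v → w ⬝ᵥ v = 0

/-- `ℓ` is an admissible loss function: `ℓ(int Δⁿ)` is an `(n - 1)`-manifold of class `C²` with a
differentiable normal vector field `N` such that, at each point, `N` or `-N` lies in the open
positive orthant. -/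
def IsAdmissible {n : ℕ} (ℓ : stdSimplex ℝ (Fin n) → Fin n → ℝ≥0∞) : Prop :=
  IsLoss ℓ ∧ IsC2Hypersurface (lossSurface ℓ) ∧
    ∃ N : (Fin n → ℝ) → Fin n → ℝ,
      DifferentiableOn ℝ N (lossSurface ℓ) ∧
      ∀ x ∈ lossSurface ℓ, IsNormalVector (lossSurface ℓ) x (N x) ∧
        ((∀ i, 0 < N x i) ∨ (∀ i, 0 < -N x i))

/-- The superprediction set of `ℓ`. -/
def spr {n : ℕ} (ℓ : stdSimplex ℝ (Fin n) → Fin n → ℝ≥0∞) : Set (Fin n → ℝ) :=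
  {x | (∀ i, 0 ≤ x i) ∧ ∃ q, ∀ i, ℓ q i ≤ ENNReal.ofReal (x i)}

/-- The `η`-exponential projection `E_η`. -/
noncomputable def expProj {n : ℕ} (η : ℝ) (y : Fin n → ℝ) : Fin n → ℝ :=
  fun i => Real.exp (-η * y i)

/-- `ℓ` is `η`-mixable: `E_η(spr(ℓ))` is convex. -/
def IsMixable {n : ℕ} (η : ℝ) (ℓ : stdSimplex ℝ (Fin n) → Fin n → ℝ≥0∞) : Prop :=
  Convex ℝ (expProj η '' spr ℓ)

/-- The log loss `p ↦ (-ln p₁, …, -ln pₙ)`, where `-ln 0 = ∞`. -/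
noncomputable def logLoss (n : ℕ) : stdSimplex ℝ (Fin n) → Fin n → ℝ≥0∞ :=
  fun p i => if p.1 i = 0 then ∞ else ENNReal.ofReal (-Real.log (p.1 i))

/-- The scaled loss `η ℓ`. -/
noncomputable def scaleLoss {n : ℕ} (η : ℝ) (ℓ : stdSimplex ℝ (Fin n) → Fin n → ℝ≥0∞) :
    stdSimplex ℝ (Fin n) → Fin n → ℝ≥0∞ :=
  fun p i => ENNReal.ofReal η * ℓ p i

/-- `L` slides freely inside `K`: for every boundary point `x` of `K` there is a translation vector
`t` with `x ∈ L + t ⊆ K`. -/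
def SlidesFreely {n : ℕ} (L K : Set (Fin n → ℝ)) : Prop :=
  ∀ x ∈ frontier K, ∃ t : Fin n → ℝ, x ∈ (fun y => y + t) '' L ∧ (fun y => y + t) '' L ⊆ K

end Mixability

/-! Both conditions amount to one inequality: (*) `∑ pᵢ exp(η (ℓᵢ(p) - yᵢ)) ≤ 1` for interior `p`
and `y ∈ spr ℓ`. Mixability gives (*) by differentiating, at `E_η(ℓ(p))`, along the segment to
`E_η(y)`: by properness `ℓ(p)` minimises `⟨p, ·⟩` on `spr ℓ`. The set `spr ℓ_log` is `{∑ exp(-xᵢ) ≤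
1}`. At its boundary point `x = -ln p`, (*) says that the translate of `spr(ηℓ)` carrying `ηℓ(p)` to
`x` stays inside. Conversely, equality in `e^u ≥ 1 + u` shows that no other point of `spr(ηℓ)` can
be carried to `x`. Finally, (*) is affine in `E_η(y)`, so it passes to convex combinations. With
`e^u ≥ 1 + u` it then puts the new point above every supporting hyperplane, hence in `spr ℓ` by
`mem_spr_of_forall_le`. -/

namespace Mixability

variable {n : ℕ} {ℓ : stdSimplex ℝ (Fin n) → Fin n → ℝ≥0∞}

/-- The point `(1 - t) p + t r` of the simplex, for `t = 1 / (k + 2)`. -/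
noncomputable def mix (p r : stdSimplex ℝ (Fin n)) (k : ℕ) : stdSimplex ℝ (Fin n) :=
  ⟨(1 - 1 / ((k : ℝ) + 2)) • p.1 + (1 / ((k : ℝ) + 2)) • r.1,
    convex_stdSimplex ℝ (Fin n) p.2 r.2
      (by rw [sub_nonneg, div_le_one (by positivity)]; linarith [k.cast_nonneg (α := ℝ)])
      (by positivity) (by ring)⟩

theorem tendsto_weight : Filter.Tendsto (fun k : ℕ => 1 / ((k : ℝ) + 2)) Filter.atTop (𝓝 0) := by
  have h := (tendsto_one_div_add_atTop_nhds_zero_nat (𝕜 := ℝ)).comp (Filter.tendsto_add_atTop_nat 1)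
  refine h.congr fun k => ?_
  simp only [Function.comp_apply, Nat.cast_add, Nat.cast_one]
  ring

theorem weight_pos (k : ℕ) : 0 < 1 / ((k : ℝ) + 2) := by positivity

theorem weight_lt_one (k : ℕ) : 1 / ((k : ℝ) + 2) < 1 := by
  rw [div_lt_one (by positivity)]; linarith [k.cast_nonneg (α := ℝ)]

theorem mix_apply (p r : stdSimplex ℝ (Fin n)) (k : ℕ) (i : Fin n) :
    (mix p r k).1 i = (1 - 1 / ((k : ℝ) + 2)) * p.1 i + 1 / ((k : ℝ) + 2) * r.1 i := rfl

theorem tendsto_mix (p r : stdSimplex ℝ (Fin n)) :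
    Filter.Tendsto (mix p r) Filter.atTop (𝓝 p) := by
  rw [tendsto_subtype_rng]
  have h : Filter.Tendsto (fun k : ℕ => (1 - 1 / ((k : ℝ) + 2)) • p.1 + (1 / ((k : ℝ) + 2)) • r.1)
      Filter.atTop (𝓝 ((1 - (0 : ℝ)) • p.1 + (0 : ℝ) • r.1)) :=
    ((tendsto_weight.const_sub 1).smul_const _).add (tendsto_weight.smul_const _)
  rw [sub_zero, one_smul, zero_smul, add_zero] at h
  exact h

theorem mix_pos (p : stdSimplex ℝ (Fin n)) {r : stdSimplex ℝ (Fin n)} (hr : ∀ j, 0 < r.1 j)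
    (k : ℕ) (j : Fin n) : 0 < (mix p r k).1 j := by
  rw [mix_apply]
  have := mul_nonneg (sub_nonneg.2 (weight_lt_one k).le) (p.2.1 j)
  have := mul_pos (weight_pos k) (hr j)
  linarith

theorem condRisk_mix (p r q : stdSimplex ℝ (Fin n)) (k : ℕ) :
    condRisk ℓ (mix p r k) q = ENNReal.ofReal (1 - 1 / ((k : ℝ) + 2)) * condRisk ℓ p q +
      ENNReal.ofReal (1 / ((k : ℝ) + 2)) * condRisk ℓ r q := by
  have h1 := sub_nonneg.2 (weight_lt_one k).le
  have h2 := (weight_pos k).le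
  simp only [condRisk, Finset.mul_sum, ← Finset.sum_add_distrib]
  refine Finset.sum_congr rfl fun i _ => ?_
  rw [mix_apply, ENNReal.ofReal_add (mul_nonneg h1 (p.2.1 i)) (mul_nonneg h2 (r.2.1 i)),
    ENNReal.ofReal_mul h1, ENNReal.ofReal_mul h2, add_mul, mul_assoc, mul_assoc]

theorem condRisk_ne_top {p q : stdSimplex ℝ (Fin n)} (hq : ∀ i, ℓ q i ≠ ∞) :
    condRisk ℓ p q ≠ ∞ :=
  ENNReal.sum_ne_top.2 fun i _ => ENNReal.mul_ne_top ENNReal.ofReal_ne_top (hq i)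

theorem toReal_condRisk {p q : stdSimplex ℝ (Fin n)} (hq : ∀ i, ℓ q i ≠ ∞) :
    (condRisk ℓ p q).toReal = ∑ i, p.1 i * (ℓ q i).toReal := by
  rw [condRisk, ENNReal.toReal_sum
    fun i _ => ENNReal.mul_ne_top ENNReal.ofReal_ne_top (hq i)]
  simp only [ENNReal.toReal_mul, ENNReal.toReal_ofReal (p.2.1 _)]

theorem continuous_condRisk (hℓ : IsLoss ℓ) (p : stdSimplex ℝ (Fin n)) :
    Continuous (condRisk ℓ p) :=
  continuous_finsetSum _ fun i _ =>
    (ENNReal.continuous_const_mul ENNReal.ofReal_ne_top).comp (hℓ.1 i)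

theorem exists_pos_stdSimplex [NeZero n] : ∃ u : stdSimplex ℝ (Fin n), ∀ j, 0 < u.1 j := by
  have hn : (0 : ℝ) < n := by exact_mod_cast Nat.pos_of_ne_zero (NeZero.ne n)
  refine ⟨⟨fun _ => 1 / n, fun _ => by positivity, ?_⟩, fun _ => by positivity⟩
  simp [hn.ne']

/-! ### Bayes risk and supporting hyperplanes -/

/-- The real-valued Bayes risk of a proper loss. -/
noncomputable def bayesRisk (ℓ : stdSimplex ℝ (Fin n) → Fin n → ℝ≥0∞)
    (p : stdSimplex ℝ (Fin n)) : ℝ :=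
  (condRisk ℓ p p).toReal

theorem bayesRisk_ne_top [NeZero n] (hℓ : IsLoss ℓ) (hp : IsProper ℓ) (p : stdSimplex ℝ (Fin n)) :
    condRisk ℓ p p ≠ ∞ := by
  obtain ⟨u, hu⟩ := exists_pos_stdSimplex (n := n)
  exact ne_top_of_le_ne_top (condRisk_ne_top (hℓ.2 u hu)) (hp p u)

theorem bayesRisk_le (hℓ : IsLoss ℓ) (hp : IsProper ℓ) (p : stdSimplex ℝ (Fin n))
    {q : stdSimplex ℝ (Fin n)} (hq : ∀ j, 0 < q.1 j) :
    bayesRisk ℓ p ≤ ∑ i, p.1 i * (ℓ q i).toReal := by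
  rw [← toReal_condRisk (hℓ.2 q hq)]
  exact ENNReal.toReal_mono (condRisk_ne_top (hℓ.2 q hq)) (hp p q)

/-- The risk is affine in its first argument. Properness bounds the `p`-term from below, and the
`r`-term is kept exact, finite because its weight is positive. -/
theorem bayesRisk_mix [NeZero n] (hℓ : IsLoss ℓ) (hp : IsProper ℓ) (p r : stdSimplex ℝ (Fin n))
    (k : ℕ) : condRisk ℓ r (mix p r k) ≠ ∞ ∧
      (1 - 1 / ((k : ℝ) + 2)) * bayesRisk ℓ p +
        1 / ((k : ℝ) + 2) * (condRisk ℓ r (mix p r k)).toReal ≤ bayesRisk ℓ (mix p r k) := by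
  have h := condRisk_mix (ℓ := ℓ) p r (mix p r k) k
  have hfin := bayesRisk_ne_top hℓ hp (mix p r k)
  have h1 := sub_pos.2 (weight_lt_one k)
  have h2 := weight_pos k
  have hsum := hfin
  rw [h, ENNReal.add_ne_top] at hsum
  have hX : condRisk ℓ p (mix p r k) ≠ ∞ := fun H => hsum.1 (by
    rw [H, ENNReal.mul_top (ENNReal.ofReal_pos.2 h1).ne'])
  have hL : condRisk ℓ r (mix p r k) ≠ ∞ := fun H => hsum.2 (by
    rw [H, ENNReal.mul_top (ENNReal.ofReal_pos.2 h2).ne'])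
  refine ⟨hL, ?_⟩
  have hle : bayesRisk ℓ p ≤ (condRisk ℓ p (mix p r k)).toReal :=
    ENNReal.toReal_mono hX (hp p _)
  have heq : bayesRisk ℓ (mix p r k) = (1 - 1 / ((k : ℝ) + 2)) * (condRisk ℓ p (mix p r k)).toReal +
      1 / ((k : ℝ) + 2) * (condRisk ℓ r (mix p r k)).toReal := by
    rw [bayesRisk, h, ENNReal.toReal_add hsum.1 hsum.2, ENNReal.toReal_mul, ENNReal.toReal_mul,
      ENNReal.toReal_ofReal h1.le, ENNReal.toReal_ofReal h2.le]
  rw [heq]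
  gcongr

/-- Near `p` the Bayes risk is dominated by the continuous affine function `L(·, q)`, where `q` is
interior and so close to `p` that `L(p, q)` is nearly `L(p, p)`. -/
theorem upperSemicontinuous_bayesRisk [NeZero n] (hℓ : IsLoss ℓ) (hp : IsProper ℓ)
    (v : Fin n → ℝ) :
    UpperSemicontinuous fun p : stdSimplex ℝ (Fin n) => bayesRisk ℓ p - ∑ i, p.1 i * v i := by
  intro p c hc
  obtain ⟨u, hu⟩ := exists_pos_stdSimplex (n := n)
  have hlim := (ENNReal.tendsto_toReal (bayesRisk_ne_top hℓ hp p)).comp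
    (((continuous_condRisk hℓ p).tendsto p).comp (tendsto_mix p u))
  obtain ⟨k, hk⟩ := (hlim.eventually_lt_const
    (show (condRisk ℓ p p).toReal < c + ∑ i, p.1 i * v i from by
      change (condRisk ℓ p p).toReal - _ < c at hc
      linarith)).exists
  have hq := mix_pos p hu k
  simp only [Function.comp_apply, toReal_condRisk (hℓ.2 _ hq)] at hk
  have hcont : Continuous fun p' : stdSimplex ℝ (Fin n) =>
      ∑ i, p'.1 i * (ℓ (mix p u k) i).toReal - ∑ i, p'.1 i * v i := by
    have : ∀ i, Continuous fun p' : stdSimplex ℝ (Fin n) => p'.1 i := fun i =>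
      (continuous_apply i).comp continuous_subtype_val
    exact (continuous_finsetSum _ fun i _ => (this i).mul continuous_const).sub
      (continuous_finsetSum _ fun i _ => (this i).mul continuous_const)
  have hev := (hcont.tendsto p).eventually_lt_const
    (show (∑ i, p.1 i * (ℓ (mix p u k) i).toReal - ∑ i, p.1 i * v i) < c by linarith)
  filter_upwards [hev] with p' hp'
  have := bayesRisk_le hℓ hp p' hq
  linarith

theorem sum_mix_mul (p r : stdSimplex ℝ (Fin n)) (k : ℕ) (v : Fin n → ℝ) :
    ∑ i, (mix p r k).1 i * v i = (1 - 1 / ((k : ℝ) + 2)) * ∑ i, p.1 i * v i +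
      1 / ((k : ℝ) + 2) * ∑ i, r.1 i * v i := by
  simp only [Finset.mul_sum, ← Finset.sum_add_distrib, mix_apply]
  exact Finset.sum_congr rfl fun i _ => by ring

/-- A point lying above all supporting hyperplanes of a proper loss is a superprediction. -/
theorem mem_spr_of_forall_le [NeZero n] (hℓ : IsLoss ℓ) (hp : IsProper ℓ) {v : Fin n → ℝ}
    (hv : ∀ p : stdSimplex ℝ (Fin n), (∀ j, 0 < p.1 j) →
      ∑ i, p.1 i * (ℓ p i).toReal ≤ ∑ i, p.1 i * v i) : v ∈ spr ℓ := by
  obtain ⟨u, hu⟩ := exists_pos_stdSimplex (n := n)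
  have : Nonempty (stdSimplex ℝ (Fin n)) := ⟨u⟩
  obtain ⟨p, -, hmax⟩ := ((upperSemicontinuous_bayesRisk hℓ hp v).upperSemicontinuousOn
    Set.univ).exists_isMaxOn Set.univ_nonempty isCompact_univ
  have hmax' : ∀ q, bayesRisk ℓ q - ∑ i, q.1 i * v i ≤ bayesRisk ℓ p - ∑ i, p.1 i * v i :=
    fun q => hmax (Set.mem_univ q)
  -- The maximiser may lie on the boundary, where `hv` says nothing; it is approached from the
  -- interior.
  have hm : bayesRisk ℓ p - ∑ i, p.1 i * v i ≤ 0 := by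
    have hlim : Filter.Tendsto (fun k : ℕ => (1 - 1 / ((k : ℝ) + 2)) *
        (bayesRisk ℓ p - ∑ i, p.1 i * v i) + 1 / ((k : ℝ) + 2) * (-∑ i, u.1 i * v i))
        Filter.atTop (𝓝 ((1 - (0 : ℝ)) * (bayesRisk ℓ p - ∑ i, p.1 i * v i) +
          (0 : ℝ) * (-∑ i, u.1 i * v i))) :=
      ((tendsto_weight.const_sub 1).mul_const _).add (tendsto_weight.mul_const _)
    rw [sub_zero, one_mul, zero_mul, add_zero] at hlim
    refine le_of_tendsto' hlim fun k => ?_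
    have h1 := (bayesRisk_mix hℓ hp p u k).2
    have h2 := sum_mix_mul p u k v
    have hpos := mix_pos p hu k
    have h3 := hv _ hpos
    rw [← toReal_condRisk (hℓ.2 _ hpos)] at h3
    change bayesRisk ℓ (mix p u k) ≤ _ at h3
    have h4 : 0 ≤ 1 / ((k : ℝ) + 2) * (condRisk ℓ u (mix p u k)).toReal :=
      mul_nonneg (weight_pos k).le ENNReal.toReal_nonneg
    rw [mul_sub, mul_neg]
    linarith
  -- Moving from the maximiser towards the vertex `eᵢ` cannot increase a maximum that is `≤ 0`; this
  -- forces `ℓᵢ ≤ vᵢ` along the way, hence at `p` in the limit.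
  have key : ∀ i k, (0 ≤ v i) ∧
      ℓ (mix p ⟨Pi.single i 1, single_mem_stdSimplex ℝ i⟩ k) i ≤ ENNReal.ofReal (v i) := by
    intro i k
    set e : stdSimplex ℝ (Fin n) := ⟨Pi.single i 1, single_mem_stdSimplex ℝ i⟩ with he
    have hcond : ∀ q, condRisk ℓ e q = ℓ q i := fun q => by
      rw [condRisk, Finset.sum_eq_single i]
      · simp [he]
      · intro j _ hj
        simp [he, hj]
      · simp
    have hsum : ∑ j, e.1 j * v j = v i := by
      simp [he, Pi.single_apply]
    obtain ⟨hfin, h1⟩ := bayesRisk_mix hℓ hp p e k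
    have h2 := sum_mix_mul p e k v
    rw [hcond] at hfin h1
    rw [hsum] at h2
    have h3 := hmax' (mix p e k)
    have hw := weight_pos k
    have hle : (ℓ (mix p e k) i).toReal ≤ v i := by
      have : 1 / ((k : ℝ) + 2) * (ℓ (mix p e k) i).toReal ≤ 1 / ((k : ℝ) + 2) * v i := by
        nlinarith
      exact le_of_mul_le_mul_left this hw
    exact ⟨ENNReal.toReal_nonneg.trans hle, (ENNReal.le_ofReal_iff_toReal_le hfin
      (ENNReal.toReal_nonneg.trans hle)).2 hle⟩
  exact ⟨fun i => (key i 0).1, p, fun i => le_of_tendsto'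
    (((hℓ.1 i).tendsto p).comp (tendsto_mix p _)) fun k => (key i k).2⟩

/-! ### The superprediction set of the log loss -/

theorem spr_logLoss [NeZero n] : spr (logLoss n) = {x | ∑ i, Real.exp (-x i) ≤ 1} := by
  ext x
  constructor
  · rintro ⟨hx, q, hq⟩
    have : ∀ i, Real.exp (-x i) ≤ q.1 i := fun i => by
      have h := hq i
      rw [logLoss] at h
      split_ifs at h with h0
      · exact absurd h (by simp)
      · have hpos := lt_of_le_of_ne (q.2.1 i) (Ne.symm h0)
        rw [ENNReal.ofReal_le_ofReal_iff (hx i)] at h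
        rw [← Real.le_log_iff_exp_le hpos]
        linarith
    exact (Finset.sum_le_sum fun i _ => this i).trans q.2.2.le
  · intro hx
    have hx : ∑ i, Real.exp (-x i) ≤ 1 := hx
    have hexp : ∀ i, Real.exp (-x i) ≤ 1 := fun i =>
      (Finset.single_le_sum (f := fun i => Real.exp (-x i)) (fun j _ => (Real.exp_pos _).le)
        (Finset.mem_univ i)).trans hx
    have h0 : ∀ i, 0 ≤ x i := fun i => by
      have := hexp i
      rw [Real.exp_le_one_iff] at this
      linarith
    have hn : (0 : ℝ) < n := by exact_mod_cast Nat.pos_of_ne_zero (NeZero.ne n)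
    -- The missing mass is shared equally; enlarging the coordinates only lowers the log loss.
    set c : ℝ := (1 - ∑ i, Real.exp (-x i)) / n with hc
    have hc0 : 0 ≤ c := div_nonneg (by linarith) hn.le
    have hq : ∀ i, 0 < Real.exp (-x i) + c := fun i => by have := Real.exp_pos (-x i); linarith
    refine ⟨h0, ⟨fun i => Real.exp (-x i) + c, fun i => (hq i).le, ?_⟩, fun i => ?_⟩
    · rw [Finset.sum_add_distrib, Finset.sum_const, Finset.card_univ, Fintype.card_fin,
        nsmul_eq_mul, hc]
      field_simp
      ring
    · rw [logLoss, if_neg (hq i).ne']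
      refine ENNReal.ofReal_le_ofReal ?_
      have := (Real.le_log_iff_exp_le (hq i)).2 (by linarith : Real.exp (-x i) ≤ _)
      change -Real.log (Real.exp (-x i) + c) ≤ x i
      linarith

theorem frontier_spr_logLoss [NeZero n] :
    frontier (spr (logLoss n)) = {x | ∑ i, Real.exp (-x i) = 1} := by
  have hcont : Continuous fun x : Fin n → ℝ => ∑ i, Real.exp (-x i) := by fun_prop
  rw [spr_logLoss]
  refine (frontier_le_subset_eq hcont continuous_const).antisymm fun x hx => ?_
  have hx : ∑ i, Real.exp (-x i) = 1 := hx
  rw [(isClosed_le hcont continuous_const).frontier_eq]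
  refine ⟨hx.le, fun hint => ?_⟩
  have hlim : Filter.Tendsto (fun k : ℕ => fun i => x i - 1 / ((k : ℝ) + 2)) Filter.atTop
      (𝓝 x) := tendsto_pi_nhds.2 fun i => by
    simpa using tendsto_weight.const_sub (x i)
  obtain ⟨k, hk⟩ := (hlim.eventually (mem_interior_iff_mem_nhds.1 hint)).exists
  refine absurd hk (not_le.2 (hx.symm.trans_lt ?_))
  exact Finset.sum_lt_sum_of_nonempty Finset.univ_nonempty fun i _ =>
    Real.exp_lt_exp.2 (neg_lt_neg (sub_lt_self _ (weight_pos k)))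

theorem mem_spr_scaleLoss {η : ℝ} (hη : 0 < η) {y : Fin n → ℝ} :
    y ∈ spr (scaleLoss η ℓ) ↔ η⁻¹ • y ∈ spr ℓ := by
  have hη0 := hη.ne'
  have hi : ∀ i, 0 ≤ (η⁻¹ • y) i ↔ 0 ≤ y i := fun i => by
    rw [Pi.smul_apply, smul_eq_mul, mul_nonneg_iff_of_pos_left (inv_pos.2 hη)]
  have hle : ∀ q i, scaleLoss η ℓ q i ≤ ENNReal.ofReal (y i) ↔
      ℓ q i ≤ ENNReal.ofReal ((η⁻¹ • y) i) := fun q i => by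
    have h : ENNReal.ofReal (y i) = ENNReal.ofReal η * ENNReal.ofReal ((η⁻¹ • y) i) := by
      rw [← ENNReal.ofReal_mul hη.le, Pi.smul_apply, smul_eq_mul, mul_inv_cancel_left₀ hη0]
    rw [scaleLoss, h, ENNReal.mul_le_mul_iff_right (ENNReal.ofReal_pos.2 hη).ne'
      ENNReal.ofReal_ne_top]
  simp only [spr, Set.mem_ofPred_eq, hi, hle]

theorem smul_mem_spr_scaleLoss {η : ℝ} (hη : 0 < η) {y : Fin n → ℝ} :
    η • y ∈ spr (scaleLoss η ℓ) ↔ y ∈ spr ℓ := by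
  rw [mem_spr_scaleLoss hη, inv_smul_smul₀ hη.ne']

theorem lossPoint_mem_spr {p : stdSimplex ℝ (Fin n)} (hp : ∀ i, ℓ p i ≠ ∞) :
    lossPoint ℓ p ∈ spr ℓ :=
  ⟨fun _ => ENNReal.toReal_nonneg, p, fun i => (ENNReal.ofReal_toReal (hp i)).ge⟩

theorem sum_lossPoint_le (hp : IsProper ℓ) {p : stdSimplex ℝ (Fin n)} (hfin : ∀ i, ℓ p i ≠ ∞)
    {y : Fin n → ℝ} (hy : y ∈ spr ℓ) :
    ∑ i, p.1 i * lossPoint ℓ p i ≤ ∑ i, p.1 i * y i := by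
  obtain ⟨h0, q, hq⟩ := hy
  have hq' : ∀ i, ℓ q i ≠ ∞ := fun i => ne_top_of_le_ne_top ENNReal.ofReal_ne_top (hq i)
  calc ∑ i, p.1 i * lossPoint ℓ p i = (condRisk ℓ p p).toReal := (toReal_condRisk hfin).symm
    _ ≤ (condRisk ℓ p q).toReal := ENNReal.toReal_mono (condRisk_ne_top hq') (hp p q)
    _ = ∑ i, p.1 i * (ℓ q i).toReal := toReal_condRisk hq'
    _ ≤ ∑ i, p.1 i * y i := Finset.sum_le_sum fun i _ =>
      mul_le_mul_of_nonneg_left (ENNReal.toReal_le_of_le_ofReal (h0 i) (hq i)) (p.2.1 i)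

/-! ### Mixability implies free sliding -/

/-- First-order condition: mixability makes `E_η (spr ℓ)` lie below the hyperplane with normal
`p / E_η (ℓ p)` through `E_η (ℓ p)`. -/
theorem IsMixable.sum_exp_le_one {η : ℝ} (hη : 0 < η) (hmix : IsMixable η ℓ) (hp : IsProper ℓ)
    {p : stdSimplex ℝ (Fin n)} (hfin : ∀ i, ℓ p i ≠ ∞) {y : Fin n → ℝ} (hy : y ∈ spr ℓ) :
    ∑ i, p.1 i * Real.exp (η * (lossPoint ℓ p i - y i)) ≤ 1 := by
  set y₀ := lossPoint ℓ p with hy₀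
  -- Points of the segment from `E_η(y₀)` to `E_η(y)` have coordinates `exp(-η y₀ᵢ) (1 + t rᵢ)`.
  set r : Fin n → ℝ := fun i => Real.exp (η * (y₀ i - y i)) - 1 with hr
  suffices h : ∑ i, p.1 i * r i ≤ 0 by
    simp only [hr, mul_sub, mul_one, Finset.sum_sub_distrib, p.2.2] at h ⊢
    linarith
  have hpos : ∀ k i, 0 < 1 + 1 / (((k : ℕ) : ℝ) + 2) * r i := fun k i => by
    have h1 : -1 < r i := by simp only [hr]; linarith [Real.exp_pos (η * (y₀ i - y i))]
    nlinarith [weight_pos k, weight_lt_one k]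
  have hlim : Filter.Tendsto
      (fun k : ℕ => ∑ i, p.1 i * (r i / (1 + 1 / ((k : ℝ) + 2) * r i))) Filter.atTop
      (𝓝 (∑ i, p.1 i * (r i / (1 + 0 * r i)))) :=
    tendsto_finsetSum _ fun i _ => (tendsto_const_nhds.div
      ((tendsto_weight.mul_const _).const_add 1) (by simp)).const_mul _
  simp only [zero_mul, add_zero, div_one] at hlim
  refine le_of_tendsto' hlim fun k => ?_
  obtain ⟨v, hv, hvE⟩ := hmix ⟨y₀, lossPoint_mem_spr hfin, rfl⟩ ⟨y, hy, rfl⟩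
    (sub_nonneg.2 (weight_lt_one k).le) (weight_pos k).le (by ring)
  have hvi : ∀ i, -η * v i = -η * y₀ i + Real.log (1 + 1 / ((k : ℝ) + 2) * r i) := fun i => by
    refine Real.exp_injective ?_
    rw [Real.exp_add, Real.exp_log (hpos k i)]
    have h := congrFun hvE i
    simp only [expProj, Pi.add_apply, Pi.smul_apply, smul_eq_mul] at h
    rw [h]
    have : Real.exp (-η * y i) = Real.exp (-η * y₀ i) * Real.exp (η * (y₀ i - y i)) := by
      rw [← Real.exp_add]; congr 1; ring
    simp only [hr]
    rw [this]
    ring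
  have hmin := sum_lossPoint_le hp hfin hv
  have hlog : ∑ i, p.1 i * Real.log (1 + 1 / ((k : ℝ) + 2) * r i) ≤ 0 := by
    have heq : ∑ i, p.1 i * Real.log (1 + 1 / ((k : ℝ) + 2) * r i) =
        η * (∑ i, p.1 i * y₀ i - ∑ i, p.1 i * v i) := by
      rw [← Finset.sum_sub_distrib, Finset.mul_sum]
      exact Finset.sum_congr rfl fun i _ => by linear_combination (-p.1 i) * hvi i
    rw [heq]
    exact mul_nonpos_of_nonneg_of_nonpos hη.le (by linarith)
  -- The bound `log u ≥ 1 - 1/u` leaves a factor `t` to divide out, so no derivative is needed.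
  have hbound : 1 / ((k : ℝ) + 2) * ∑ i, p.1 i * (r i / (1 + 1 / ((k : ℝ) + 2) * r i)) ≤ 0 := by
    refine le_trans ?_ hlog
    rw [Finset.mul_sum]
    refine Finset.sum_le_sum fun i _ => ?_
    have h := Real.one_sub_inv_le_log_of_pos (hpos k i)
    have h' : 1 - (1 + 1 / ((k : ℝ) + 2) * r i)⁻¹ =
        1 / ((k : ℝ) + 2) * (r i / (1 + 1 / ((k : ℝ) + 2) * r i)) := by
      have := (hpos k i).ne'
      generalize 1 / ((k : ℝ) + 2) = w at *
      field_simp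
      ring
    rw [h'] at h
    calc _ = p.1 i * (1 / ((k : ℝ) + 2) * (r i / (1 + 1 / ((k : ℝ) + 2) * r i))) := by ring
      _ ≤ _ := mul_le_mul_of_nonneg_left h (p.2.1 i)
  exact nonpos_of_mul_nonpos_right hbound (weight_pos k)

theorem IsMixable.slidesFreely [NeZero n] {η : ℝ} (hη : 0 < η) (hmix : IsMixable η ℓ)
    (hℓ : IsLoss ℓ) (hp : IsProper ℓ) :
    SlidesFreely (spr (scaleLoss η ℓ)) (spr (logLoss n)) := by
  intro x hx
  rw [frontier_spr_logLoss] at hx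
  set p : stdSimplex ℝ (Fin n) :=
    ⟨fun i => Real.exp (-x i), fun i => (Real.exp_pos _).le, hx⟩ with hpdef
  have hfin : ∀ i, ℓ p i ≠ ∞ := hℓ.2 p fun i => Real.exp_pos _
  refine ⟨x - η • lossPoint ℓ p, ⟨η • lossPoint ℓ p,
    (smul_mem_spr_scaleLoss hη).2 (lossPoint_mem_spr hfin), by simp⟩, ?_⟩
  rintro _ ⟨y, hy, rfl⟩
  rw [mem_spr_scaleLoss hη] at hy
  rw [spr_logLoss]
  refine le_trans (le_of_eq ?_) (hmix.sum_exp_le_one hη hp hfin hy)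
  refine Finset.sum_congr rfl fun i _ => ?_
  rw [hpdef, ← Real.exp_add]
  congr 1
  simp only [Pi.add_apply, Pi.sub_apply, Pi.smul_apply, smul_eq_mul, mul_sub,
    mul_inv_cancel_left₀ hη.ne']
  ring

/-! ### Free sliding implies mixability -/

theorem SlidesFreely.sum_exp_le_one [NeZero n] {η : ℝ} (hη : 0 < η)
    (hs : SlidesFreely (spr (scaleLoss η ℓ)) (spr (logLoss n))) (hℓ : IsLoss ℓ) (hp : IsProper ℓ)
    {p : stdSimplex ℝ (Fin n)} (hpos : ∀ j, 0 < p.1 j) {y : Fin n → ℝ} (hy : y ∈ spr ℓ) :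
    ∑ i, p.1 i * Real.exp (η * (lossPoint ℓ p i - y i)) ≤ 1 := by
  have hfin := hℓ.2 p hpos
  obtain ⟨t, ⟨y₀, hy₀, hyt⟩, hsub⟩ := hs (fun i => -Real.log (p.1 i)) (by
    rw [frontier_spr_logLoss]
    simp only [Set.mem_ofPred_eq, neg_neg, Real.exp_log (hpos _)]
    exact p.2.2)
  have hall : ∀ y ∈ spr ℓ, ∑ i, p.1 i * Real.exp (y₀ i - η * y i) ≤ 1 := fun y hy => by
    have h := hsub ⟨η • y, (smul_mem_spr_scaleLoss hη).2 hy, rfl⟩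
    rw [spr_logLoss] at h
    refine le_trans (le_of_eq (Finset.sum_congr rfl fun i _ => ?_)) h
    have ht : y₀ i + t i = -Real.log (p.1 i) := congrFun hyt i
    nth_rw 1 [← Real.exp_log (hpos i)]
    rw [← Real.exp_add]
    congr 1
    simp only [Pi.add_apply, Pi.smul_apply, smul_eq_mul]
    linarith
  have hge : η * ∑ i, p.1 i * lossPoint ℓ p i ≤ ∑ i, p.1 i * y₀ i := by
    have h := sum_lossPoint_le hp hfin ((mem_spr_scaleLoss hη).1 hy₀)
    calc _ ≤ η * ∑ i, p.1 i * (η⁻¹ • y₀) i := mul_le_mul_of_nonneg_left h hη.le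
      _ = _ := by
        rw [Finset.mul_sum]
        refine Finset.sum_congr rfl fun i _ => ?_
        rw [Pi.smul_apply, smul_eq_mul]
        field_simp
  -- Properness makes the `p`-mean of `y₀ - ηℓ(p)` nonnegative, while its exponential has mean at
  -- most 1. Since every `pᵢ > 0`, strictness of `e^u > 1 + u` for `u ≠ 0` leaves only zero.
  have heq : ∀ i, y₀ i = η * lossPoint ℓ p i := by
    by_contra! hne
    obtain ⟨j, hj⟩ := hne
    have hlt : ∑ i, p.1 i * (y₀ i - η * lossPoint ℓ p i + 1) <
        ∑ i, p.1 i * Real.exp (y₀ i - η * lossPoint ℓ p i) :=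
      Finset.sum_lt_sum (fun i _ => mul_le_mul_of_nonneg_left (Real.add_one_le_exp _) (p.2.1 i))
        ⟨j, Finset.mem_univ j, mul_lt_mul_of_pos_left
          (Real.add_one_lt_exp (sub_ne_zero.2 hj)) (hpos j)⟩
    have hexpand : ∑ i, p.1 i * (y₀ i - η * lossPoint ℓ p i + 1) =
        ∑ i, p.1 i * y₀ i - η * ∑ i, p.1 i * lossPoint ℓ p i + 1 := by
      simp only [mul_add, mul_one, Finset.sum_add_distrib, p.2.2, Finset.mul_sum,
        ← Finset.sum_sub_distrib, add_left_inj]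
      exact Finset.sum_congr rfl fun i _ => by ring
    have := hall _ (lossPoint_mem_spr hfin)
    linarith
  simpa only [heq, ← mul_sub] using hall y hy

theorem SlidesFreely.isMixable [NeZero n] {η : ℝ} (hη : 0 < η)
    (hs : SlidesFreely (spr (scaleLoss η ℓ)) (spr (logLoss n))) (hℓ : IsLoss ℓ)
    (hp : IsProper ℓ) : IsMixable η ℓ := by
  rintro _ ⟨y, hy, rfl⟩ _ ⟨y', hy', rfl⟩ a b ha hb hab
  have hw : ∀ i, 0 < (a • expProj η y + b • expProj η y') i := fun i => by
    simp only [expProj, Pi.add_apply, Pi.smul_apply, smul_eq_mul]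
    rcases ha.eq_or_lt with rfl | ha
    · rw [zero_add] at hab
      subst hab
      simpa using Real.exp_pos _
    · exact add_pos_of_pos_of_nonneg (by positivity) (by positivity)
  set w := a • expProj η y + b • expProj η y' with hwdef
  set v : Fin n → ℝ := fun i => -(η⁻¹ * Real.log (w i)) with hvdef
  have hηv : ∀ i, η * v i = -Real.log (w i) := fun i => by
    simp only [hvdef]; rw [mul_neg, mul_inv_cancel_left₀ hη.ne']
  have hexp : ∀ i, Real.exp (-η * v i) = w i := fun i => by
    rw [neg_mul, hηv, neg_neg, Real.exp_log (hw i)]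
  refine ⟨v, mem_spr_of_forall_le hℓ hp fun p hpos => ?_, funext hexp⟩
  have h1 := hs.sum_exp_le_one hη hℓ hp hpos hy
  have h2 := hs.sum_exp_le_one hη hℓ hp hpos hy'
  have hsum : ∑ i, p.1 i * Real.exp (η * (lossPoint ℓ p i - v i)) ≤ 1 := by
    calc _ = a * ∑ i, p.1 i * Real.exp (η * (lossPoint ℓ p i - y i)) +
          b * ∑ i, p.1 i * Real.exp (η * (lossPoint ℓ p i - y' i)) := by
          rw [Finset.mul_sum, Finset.mul_sum, ← Finset.sum_add_distrib]
          refine Finset.sum_congr rfl fun i _ => ?_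
          have hs : ∀ u : ℝ, Real.exp (η * (lossPoint ℓ p i - u)) =
              Real.exp (η * lossPoint ℓ p i) * Real.exp (-η * u) := fun u => by
            rw [← Real.exp_add]; congr 1; ring
          rw [hs, hs, hs, hexp, hwdef]
          simp only [expProj, Pi.add_apply, Pi.smul_apply, smul_eq_mul]
          ring
      _ ≤ a * 1 + b * 1 := by gcongr
      _ = 1 := by rw [mul_one, mul_one, hab]
  have hlin : ∑ i, p.1 i * (η * (lossPoint ℓ p i - v i) + 1) ≤ 1 :=
    (Finset.sum_le_sum fun i _ =>
      mul_le_mul_of_nonneg_left (Real.add_one_le_exp _) (p.2.1 i)).trans hsum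
  have hexpand : ∑ i, p.1 i * (η * (lossPoint ℓ p i - v i) + 1) =
      η * (∑ i, p.1 i * lossPoint ℓ p i - ∑ i, p.1 i * v i) + 1 := by
    simp only [mul_add, mul_one, Finset.sum_add_distrib, p.2.2, Finset.mul_sum,
      ← Finset.sum_sub_distrib, add_left_inj]
    exact Finset.sum_congr rfl fun i _ => by ring
  have hfinal : η * (∑ i, p.1 i * lossPoint ℓ p i - ∑ i, p.1 i * v i) ≤ 0 := by linarith
  have := nonpos_of_mul_nonpos_right hfinal hη
  change ∑ i, p.1 i * lossPoint ℓ p i ≤ _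
  linarith

end Mixability

theorem mainTheorem1 {n : ℕ} (ℓ : stdSimplex ℝ (Fin n) → Fin n → ENNReal)
    (hadm : Mixability.IsAdmissible ℓ) (hproper : Mixability.IsProper ℓ)
    (η : ℝ) (hη : 0 < η) :
    Mixability.IsMixable η ℓ ↔
      Mixability.SlidesFreely (Mixability.spr (Mixability.scaleLoss η ℓ))
        (Mixability.spr (Mixability.logLoss n)) := by
  rcases Nat.eq_zero_or_pos n with rfl | hn
  -- For `n = 0` the simplex is empty, so all superprediction sets are empty and both sides hold.
  · have hempty : IsEmpty (stdSimplex ℝ (Fin 0)) := ⟨fun p => by simpa using p.2.2⟩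
    have hspr : ∀ m : stdSimplex ℝ (Fin 0) → Fin 0 → ENNReal, Mixability.spr m = ∅ := fun m =>
      Set.eq_empty_of_forall_notMem fun x hx => hempty.elim hx.2.choose
    simp [Mixability.IsMixable, Mixability.SlidesFreely, hspr, convex_empty]
  · have : NeZero n := ⟨hn.ne'⟩
    exact ⟨fun h => h.slidesFreely hη hadm.1 hproper, fun h => h.isMixable hη hadm.1 hproper⟩
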